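/- We consider the situation calculus with the sorts object, action, situation and time, where time is interpreted by the real numbers with $+,-,\times,<$ and natural-number constants. **Timed basic action theories.** A *timed basic action theory* (timed BAT) $\mathcal D$ is given by a finite vocabulary: a finite nonempty set of object constants; finitely many action types $A$, each with finitely many object arguments and one final argument of sort time; finitely many relational and functional fluents with arguments of sort object and a final situation argument, functional ones having values of sort object or time; and finitely many rigid relation and function symbols with arguments of sort object, rigid functions having values of sort object or time. Its axioms are * finitely many sentences uniform in $S_0$, giving complete information: $\mathcal D\models\phi$ or $\mathcal D\models\neg\phi$ for each closed atomic $\phi$ uniform in $S_0$; * for each action type a precondition axiom $\mathrm{Poss}(A(\vec x,t),s)\equiv\phi_A(\vec x,t,s)$; * for each relational fluent a successor state axiom $F(\vec x,do(a,s))\equiv\phi_F(\vec x,a,s)$, and for each functional fluent one of the form $f(\vec x,do(a,s))=y\equiv\phi_f(\vec x,y,a,s)$; * unique names and domain closure for objects and for actions; * the foundational axioms of situations: $do(a,s)=do(a',s')\supset a=a'\wedge s=s'$, second-order induction over situations, $\neg\, s\sqsubset S_0$, and $s\sqsubset do(a,s')\equiv s\sqsubseteq s'$; * the axioms $time(A(\vec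 x,t))=t$ and $start(do(a,s))=time(a)$. Here $\phi_A,\phi_F,\phi_f$ are first-order formulas uniform in $s$: they mention no situation term other than $s$ and do not mention $\mathrm{Poss}$; they quantify only over objects, times and actions. Their atoms are equalities of terms of sort object, time or action, comparisons of times, fluents and rigid relations, and $occurs_T(a,t)$ evaluated at $s$, which says that $a$ has occurred at time $t$ on the path of situations leading to $s$, i.e. $\exists s'\,(do(a,s')\sqsubseteq s\wedge start(do(a,s'))=t)$. Terms may use $start(s)$ and $time(a)$. **Reachability.** A situation $s$ is executable, $exec(s)$, if $\mathrm{Poss}(a,s')$ holds whenever $do(a,s')\sqsubseteq s$. The *reachability problem* asks, given $\mathcal D$ and a closed formula $\phi$ uniform in $s$, whether $\mathcal D\models\exists s\,(exec(s)\wedge\phi[s])$, i.e. whether this holds in all models of $\mathcal D$. **Theorem.** The reachability problem for timed BATs without any fluent of sort time is undecidable: no computable function gives, for (the Gödel number of) every pair $(\mathcal D,\phi)$ consisting of a satisfiable timed BAT $\mathcal D$ without functional fluents of sort time and a closed formula $\phi$ uniform in $s$, the correct answer to whether $\phi$ is reachable in $\mathcal D$. -/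

import Mathlib

namespace SitCalc

/-- The sorts that may occur in a formula that is uniform in a situation. -/
inductive Srt
  | obj
  | time
  | act

/-- The domain-specific vocabulary of a timed basic action theory with finitely many objects.
Every list has one entry per symbol, namely the number of its object arguments; the situation
argument of a fluent and the time argument of an action type are not counted. -/
structure Signature where
  /-- number of object constants -/
  numObj : ℕ
  /-- action types -/
  actions : List ℕ
  /-- relational fluents -/
  relFluents : List ℕ
  /-- functional fluents of sort object -/
  objFluents : List ℕ
  /-- functional fluents of sort time -/
  timeFluents : List ℕ
  /-- rigid relation symbols -/
  rigidRels : List ℕ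
  /-- rigid function symbols of sort object -/
  rigidObjFuns : List ℕ
  /-- rigid function symbols of sort time -/
  rigidTimeFuns : List ℕ

/-- Situation-suppressed terms with `o` object, `t` time and `a` action variables. -/
inductive Term (S : Signature) (o t a : ℕ) : Srt → Type
  | objVar (i : Fin o) : Term S o t a .obj
  | timeVar (i : Fin t) : Term S o t a .time
  | actVar (i : Fin a) : Term S o t a .act
  | const (c : Fin S.numObj) : Term S o t a .obj
  | objFluent (f : Fin S.objFluents.length)
      (args : Fin (S.objFluents.get f) → Term S o t a .obj) : Term S o t a .obj
  | timeFluent (f : Fin S.timeFluents.length)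
      (args : Fin (S.timeFluents.get f) → Term S o t a .obj) : Term S o t a .time
  | rigidObj (f : Fin S.rigidObjFuns.length)
      (args : Fin (S.rigidObjFuns.get f) → Term S o t a .obj) : Term S o t a .obj
  | rigidTime (f : Fin S.rigidTimeFuns.length)
      (args : Fin (S.rigidTimeFuns.get f) → Term S o t a .obj) : Term S o t a .time
  | num (n : ℕ) : Term S o t a .time
  | add (x y : Term S o t a .time) : Term S o t a .time
  | sub (x y : Term S o t a .time) : Term S o t a .time
  | mul (x y : Term S o t a .time) : Term S o t a .time
  /-- the starting time of the (suppressed) situation -/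
  | start : Term S o t a .time
  /-- the time of occurrence of an action -/
  | timeOf (x : Term S o t a .act) : Term S o t a .time
  /-- the action term `A(args, x)` -/
  | act (A : Fin S.actions.length) (args : Fin (S.actions.get A) → Term S o t a .obj)
      (x : Term S o t a .time) : Term S o t a .act

/-- Situation-suppressed formulas, that is, formulas uniform in one situation `s`: they mention
no situation term but `s`, do not mention `Poss`, and quantify only over objects, times and
actions. A quantifier binds the last variable of its sort. -/
inductive Formula (S : Signature) : ℕ → ℕ → ℕ → Type
  | falsum {o t a : ℕ} : Formula S o t a
  | eqObj {o t a : ℕ} (x y : Term S o t a .obj) : Formula S o t a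
  | eqTime {o t a : ℕ} (x y : Term S o t a .time) : Formula S o t a
  | eqAct {o t a : ℕ} (x y : Term S o t a .act) : Formula S o t a
  | lt {o t a : ℕ} (x y : Term S o t a .time) : Formula S o t a
  | rel {o t a : ℕ} (R : Fin S.relFluents.length)
      (args : Fin (S.relFluents.get R) → Term S o t a .obj) : Formula S o t a
  | rigidRel {o t a : ℕ} (R : Fin S.rigidRels.length)
      (args : Fin (S.rigidRels.get R) → Term S o t a .obj) : Formula S o t a
  /-- action `x` has occurred at time `y` on the way to the (suppressed) situation -/
  | occursT {o t a : ℕ} (x : Term S o t a .act) (y : Term S o t a .time) : Formula S o t a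
  | imp {o t a : ℕ} (p q : Formula S o t a) : Formula S o t a
  | allObj {o t a : ℕ} (p : Formula S (o + 1) t a) : Formula S o t a
  | allTime {o t a : ℕ} (p : Formula S o (t + 1) a) : Formula S o t a
  | allAct {o t a : ℕ} (p : Formula S o t (a + 1)) : Formula S o t a

/-- Closed situation-suppressed formulas. -/
abbrev Sentence (S : Signature) : Type := Formula S 0 0 0

def Formula.neg {S : Signature} {o t a : ℕ} (p : Formula S o t a) : Formula S o t a :=
  .imp p .falsum

def Formula.IsAtomic {S : Signature} {o t a : ℕ} : Formula S o t a → Prop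
  | .eqObj _ _ | .eqTime _ _ | .eqAct _ _ | .lt _ _ | .rel _ _ | .rigidRel _ _
  | .occursT _ _ => True
  | _ => False

/-- The domain-specific axioms of a timed basic action theory. -/
structure TimedBAT (S : Signature) where
  /-- the description of the initial situation -/
  initial : List (Sentence S)
  /-- `Poss(A(x₁, …, xₖ, t), s) ≡ φ_A(x₁, …, xₖ, t, s)` -/
  poss : (A : Fin S.actions.length) → Formula S (S.actions.get A) 1 0
  /-- `F(x₁, …, xₖ, do(a, s)) ≡ φ_F(x₁, …, xₖ, a, s)` -/
  ssaRel : (F : Fin S.relFluents.length) → Formula S (S.relFluents.get F) 0 1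
  /-- `f(x₁, …, xₖ, do(a, s)) = y ≡ φ_f(x₁, …, xₖ, y, a, s)` with `y` of sort object -/
  ssaObj : (f : Fin S.objFluents.length) → Formula S (S.objFluents.get f + 1) 0 1
  /-- `f(x₁, …, xₖ, do(a, s)) = y ≡ φ_f(x₁, …, xₖ, y, a, s)` with `y` of sort time -/
  ssaTime : (f : Fin S.timeFluents.length) → Formula S (S.timeFluents.get f) 1 1

/-! ### Semantics -/

/-- An interpretation of the language. The sort time is interpreted by the real numbers. -/
structure Interp (S : Signature) where
  Obj : Type
  Act : Type
  Sit : Type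
  const : Fin S.numObj → Obj
  act : (A : Fin S.actions.length) → (Fin (S.actions.get A) → Obj) → ℝ → Act
  s0 : Sit
  doAct : Act → Sit → Sit
  /-- the ordering `⊏` of situations -/
  before : Sit → Sit → Prop
  poss : Act → Sit → Prop
  time : Act → ℝ
  start : Sit → ℝ
  rel : (F : Fin S.relFluents.length) → (Fin (S.relFluents.get F) → Obj) → Sit → Prop
  objFluent : (f : Fin S.objFluents.length) → (Fin (S.objFluents.get f) → Obj) → Sit → Obj
  timeFluent : (f : Fin S.timeFluents.length) → (Fin (S.timeFluents.get f) → Obj) → Sit → ℝ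
  rigidRel : (R : Fin S.rigidRels.length) → (Fin (S.rigidRels.get R) → Obj) → Prop
  rigidObj : (f : Fin S.rigidObjFuns.length) → (Fin (S.rigidObjFuns.get f) → Obj) → Obj
  rigidTime : (f : Fin S.rigidTimeFuns.length) → (Fin (S.rigidTimeFuns.get f) → Obj) → ℝ

namespace Interp

variable {S : Signature} (M : Interp S)

abbrev Carrier : Srt → Type
  | .obj => M.Obj
  | .time => ℝ
  | .act => M.Act

/-- `s ⊑ s'` -/
def beforeEq (s s' : M.Sit) : Prop := M.before s s' ∨ s = s'

/-- `exec(s)`: every action performed in reaching `s` was possible where it was performed. -/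
def Exec (s : M.Sit) : Prop :=
  ∀ (α : M.Act) (s' : M.Sit), M.beforeEq (M.doAct α s') s → M.poss α s'

/-- `occurs_T(α, τ)` along the actual path of situations that leads to `s`: the situations that
have actually occurred are those `⊑ s`, and `α` is the action of a step of this path
whose resulting situation starts at `τ`. -/
def OccursT (α : M.Act) (τ : ℝ) (s : M.Sit) : Prop :=
  ∃ s', M.beforeEq (M.doAct α s') s ∧ M.start (M.doAct α s') = τ

def eval (s : M.Sit) {o t a : ℕ} (vo : Fin o → M.Obj) (vt : Fin t → ℝ) (va : Fin a → M.Act) :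
    {σ : Srt} → Term S o t a σ → M.Carrier σ
  | _, .objVar i => vo i
  | _, .timeVar i => vt i
  | _, .actVar i => va i
  | _, .const c => M.const c
  | _, .objFluent f args => M.objFluent f (fun i => eval s vo vt va (args i)) s
  | _, .timeFluent f args => M.timeFluent f (fun i => eval s vo vt va (args i)) s
  | _, .rigidObj f args => M.rigidObj f (fun i => eval s vo vt va (args i))
  | _, .rigidTime f args => M.rigidTime f (fun i => eval s vo vt va (args i))
  | _, .num n => (n : ℝ)
  | _, .add x y =>
      let u : ℝ := eval s vo vt va x
      let v : ℝ := eval s vo vt va y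
      u + v
  | _, .sub x y =>
      let u : ℝ := eval s vo vt va x
      let v : ℝ := eval s vo vt va y
      u - v
  | _, .mul x y =>
      let u : ℝ := eval s vo vt va x
      let v : ℝ := eval s vo vt va y
      u * v
  | _, .start => M.start s
  | _, .timeOf x => M.time (eval s vo vt va x)
  | _, .act A args x => M.act A (fun i => eval s vo vt va (args i)) (eval s vo vt va x)

/-- `M ⊨ φ[s]` under an assignment of the free variables. -/
def Sat (s : M.Sit) : {o t a : ℕ} → (Fin o → M.Obj) → (Fin t → ℝ) → (Fin a → M.Act) →
    Formula S o t a → Prop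
  | _, _, _, _, _, _, .falsum => False
  | _, _, _, vo, vt, va, .eqObj x y => M.eval s vo vt va x = M.eval s vo vt va y
  | _, _, _, vo, vt, va, .eqTime x y =>
      let u : ℝ := M.eval s vo vt va x
      let v : ℝ := M.eval s vo vt va y
      u = v
  | _, _, _, vo, vt, va, .eqAct x y => M.eval s vo vt va x = M.eval s vo vt va y
  | _, _, _, vo, vt, va, .lt x y =>
      let u : ℝ := M.eval s vo vt va x
      let v : ℝ := M.eval s vo vt va y
      u < v
  | _, _, _, vo, vt, va, .rel F args => M.rel F (fun i => M.eval s vo vt va (args i)) s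
  | _, _, _, vo, vt, va, .rigidRel R args => M.rigidRel R (fun i => M.eval s vo vt va (args i))
  | _, _, _, vo, vt, va, .occursT x y =>
      M.OccursT (M.eval s vo vt va x) (M.eval s vo vt va y) s
  | _, _, _, vo, vt, va, .imp p q => Sat s vo vt va p → Sat s vo vt va q
  | _, _, _, vo, vt, va, .allObj p => ∀ d : M.Obj, Sat s (Fin.snoc vo d) vt va p
  | _, _, _, vo, vt, va, .allTime p => ∀ d : ℝ, Sat s vo (Fin.snoc vt d) va p
  | _, _, _, vo, vt, va, .allAct p => ∀ d : M.Act, Sat s vo vt (Fin.snoc va d) p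

/-- `M ⊨ φ[s]` for a sentence. -/
def Holds (s : M.Sit) (φ : Sentence S) : Prop :=
  M.Sat s Fin.elim0 Fin.elim0 Fin.elim0 φ

/-- The foundational axioms of the situation calculus, with the second-order induction axiom,
and the axioms for `time` and `start`. -/
structure Foundational : Prop where
  doAct_inj : ∀ α β s s', M.doAct α s = M.doAct β s' → α = β ∧ s = s'
  induction : ∀ P : M.Sit → Prop, P M.s0 → (∀ α s, P s → P (M.doAct α s)) → ∀ s, P s
  not_before_s0 : ∀ s, ¬ M.before s M.s0
  before_doAct : ∀ α s s', M.before s (M.doAct α s') ↔ M.beforeEq s s'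
  time_act : ∀ A x (τ : ℝ), M.time (M.act A x τ) = τ
  start_doAct : ∀ α s, M.start (M.doAct α s) = M.time α

/-- Unique names and domain closure for objects and for actions. -/
structure NamesAndClosure : Prop where
  const_inj : Function.Injective M.const
  const_surj : Function.Surjective M.const
  act_closure : ∀ α, ∃ A x τ, α = M.act A x τ
  act_ne : ∀ A B x y (τ τ' : ℝ), A ≠ B → M.act A x τ ≠ M.act B y τ'
  act_inj : ∀ A x y (τ τ' : ℝ), M.act A x τ = M.act A y τ' → x = y ∧ τ = τ'

/-- `M` is a model of all axioms of the timed basic action theory `D`. -/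
structure IsModel (D : TimedBAT S) : Prop where
  foundational : M.Foundational
  names : M.NamesAndClosure
  initial : ∀ φ ∈ D.initial, M.Holds M.s0 φ
  poss : ∀ A x (τ : ℝ) s,
    M.poss (M.act A x τ) s ↔ M.Sat s x (fun _ => τ) Fin.elim0 (D.poss A)
  ssaRel : ∀ F x α s,
    M.rel F x (M.doAct α s) ↔ M.Sat s x Fin.elim0 (fun _ => α) (D.ssaRel F)
  ssaObj : ∀ f x y α s, M.objFluent f x (M.doAct α s) = y ↔
    M.Sat s (Fin.snoc x y) Fin.elim0 (fun _ => α) (D.ssaObj f)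
  ssaTime : ∀ f x (y : ℝ) α s, M.timeFluent f x (M.doAct α s) = y ↔
    M.Sat s x (fun _ => y) (fun _ => α) (D.ssaTime f)

end Interp

namespace TimedBAT

variable {S : Signature} (D : TimedBAT S)

def Consistent : Prop := ∃ M : Interp S, M.IsModel D

/-- `D ⊨ φ[S₀]` -/
def EntailsInitially (φ : Sentence S) : Prop :=
  ∀ M : Interp S, M.IsModel D → M.Holds M.s0 φ

/-- Complete information: `D` decides every closed atomic formula uniform in `S₀`. -/
def CompleteInformation : Prop :=
  ∀ φ : Sentence S, φ.IsAtomic → D.EntailsInitially φ ∨ D.EntailsInitially φ.neg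

/-- `φ` is reachable: `D ⊨ ∃ s. exec(s) ∧ φ[s]`. -/
def Reachable (φ : Sentence S) : Prop :=
  ∀ M : Interp S, M.IsModel D → ∃ s, M.Exec s ∧ M.Holds s φ

/-- `D` includes a fluent of sort time. -/
def IsRealValued (_D : TimedBAT S) : Prop := S.timeFluents ≠ []

end TimedBAT

/-! ### Gödel numbering of the instances of the reachability problem -/

/-- The code of a finite list of codes, given as a function. -/
def codeFn {n : ℕ} (g : Fin n → ℕ) : ℕ := Encodable.encode (List.ofFn g)

theorem codeFn_inj {n : ℕ} {g h : Fin n → ℕ} (e : codeFn g = codeFn h) : g = h :=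
  List.ofFn_injective (Encodable.encode_injective e)

def Signature.code (S : Signature) : ℕ :=
  Encodable.encode (S.numObj, S.actions, S.relFluents, S.objFluents, S.timeFluents,
    S.rigidRels, S.rigidObjFuns, S.rigidTimeFuns)

def Term.code {S : Signature} {o t a : ℕ} : {σ : Srt} → Term S o t a σ → ℕ
  | _, .objVar i => Nat.pair 0 i
  | _, .timeVar i => Nat.pair 1 i
  | _, .actVar i => Nat.pair 2 i
  | _, .const c => Nat.pair 3 c
  | _, .objFluent f args => Nat.pair 4 (Nat.pair f (codeFn fun i => code (args i)))
  | _, .timeFluent f args => Nat.pair 5 (Nat.pair f (codeFn fun i => code (args i)))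
  | _, .rigidObj f args => Nat.pair 6 (Nat.pair f (codeFn fun i => code (args i)))
  | _, .rigidTime f args => Nat.pair 7 (Nat.pair f (codeFn fun i => code (args i)))
  | _, .num n => Nat.pair 8 n
  | _, .add x y => Nat.pair 9 (Nat.pair (code x) (code y))
  | _, .sub x y => Nat.pair 10 (Nat.pair (code x) (code y))
  | _, .mul x y => Nat.pair 11 (Nat.pair (code x) (code y))
  | _, .start => Nat.pair 12 0
  | _, .timeOf x => Nat.pair 13 (code x)
  | _, .act A args x =>
      Nat.pair 14 (Nat.pair A (Nat.pair (codeFn fun i => code (args i)) (code x)))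

def Formula.code {S : Signature} : {o t a : ℕ} → Formula S o t a → ℕ
  | _, _, _, .falsum => Nat.pair 0 0
  | _, _, _, .eqObj x y => Nat.pair 1 (Nat.pair x.code y.code)
  | _, _, _, .eqTime x y => Nat.pair 2 (Nat.pair x.code y.code)
  | _, _, _, .eqAct x y => Nat.pair 3 (Nat.pair x.code y.code)
  | _, _, _, .lt x y => Nat.pair 4 (Nat.pair x.code y.code)
  | _, _, _, .rel F args => Nat.pair 5 (Nat.pair F (codeFn fun i => (args i).code))
  | _, _, _, .rigidRel R args => Nat.pair 6 (Nat.pair R (codeFn fun i => (args i).code))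
  | _, _, _, .occursT x y => Nat.pair 7 (Nat.pair x.code y.code)
  | _, _, _, .imp p q => Nat.pair 8 (Nat.pair (code p) (code q))
  | _, _, _, .allObj p => Nat.pair 9 (code p)
  | _, _, _, .allTime p => Nat.pair 10 (code p)
  | _, _, _, .allAct p => Nat.pair 11 (code p)

def TimedBAT.code {S : Signature} (D : TimedBAT S) : ℕ :=
  Nat.pair (Encodable.encode (D.initial.map Formula.code))
    (Nat.pair (codeFn fun A => (D.poss A).code)
      (Nat.pair (codeFn fun F => (D.ssaRel F).code)
        (Nat.pair (codeFn fun f => (D.ssaObj f).code) (codeFn fun f => (D.ssaTime f).code))))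

/-- An instance of the reachability problem: a timed basic action theory (over some signature)
and a property. -/
structure ReachInstance where
  sig : Signature
  bat : TimedBAT sig
  query : Sentence sig

def ReachInstance.code (I : ReachInstance) : ℕ :=
  Nat.pair I.sig.code (Nat.pair I.bat.code I.query.code)

theorem Signature.code_injective : Function.Injective Signature.code := by
  intro S T h
  have h := Encodable.encode_injective h
  cases S
  cases T
  simp_all

theorem Term.code_injective {S : Signature} {o t a : ℕ} {σ : Srt} (x y : Term S o t a σ)
    (h : x.code = y.code) : x = y := by
  induction x with
  | objFluent f args ih | timeFluent f args ih | rigidObj f args ih | rigidTime f args ih =>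
    cases y <;> simp only [Term.code, Nat.pair_eq_pair] at h <;> try omega
    obtain ⟨-, h1, h2⟩ := h
    obtain rfl := Fin.ext h1
    congr 1
    exact funext fun i => ih i _ (congrFun (codeFn_inj h2) i)
  | act A args x ih ihx =>
    cases y <;> simp only [Term.code, Nat.pair_eq_pair] at h <;> try omega
    obtain ⟨-, h1, h2, h3⟩ := h
    obtain rfl := Fin.ext h1
    rw [ihx _ h3]
    congr 1
    exact funext fun i => ih i _ (congrFun (codeFn_inj h2) i)
  | add x y ihx ihy | sub x y ihx ihy | mul x y ihx ihy =>
    cases y <;> simp only [Term.code, Nat.pair_eq_pair] at h <;> try omega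
    rw [ihx _ h.2.1, ihy _ h.2.2]
  | timeOf x ih =>
    cases y <;> simp only [Term.code, Nat.pair_eq_pair] at h <;> try omega
    rw [ih _ h.2]
  | objVar i | timeVar i | actVar i | const i | num i | start =>
    cases y <;> simp only [Term.code, Nat.pair_eq_pair] at h <;> try omega
    all_goals first | rfl | (congr 1; omega)

theorem Formula.code_injective {S : Signature} {o t a : ℕ} (p q : Formula S o t a)
    (h : p.code = q.code) : p = q := by
  induction p with
  | falsum =>
    cases q <;> simp only [Formula.code, Nat.pair_eq_pair] at h <;> first | rfl | omega
  | eqObj x y | eqTime x y | eqAct x y | lt x y | occursT x y =>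
    cases q <;> simp only [Formula.code, Nat.pair_eq_pair] at h <;> try omega
    rw [Term.code_injective _ _ h.2.1, Term.code_injective _ _ h.2.2]
  | rel F args | rigidRel F args =>
    cases q <;> simp only [Formula.code, Nat.pair_eq_pair] at h <;> try omega
    obtain ⟨-, h1, h2⟩ := h
    obtain rfl := Fin.ext h1
    congr 1
    exact funext fun i => Term.code_injective _ _ (congrFun (codeFn_inj h2) i)
  | imp p q ihp ihq =>
    cases q <;> simp only [Formula.code, Nat.pair_eq_pair] at h <;> try omega
    rw [ihp _ h.2.1, ihq _ h.2.2]
  | allObj p ih | allTime p ih | allAct p ih =>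
    cases q <;> simp only [Formula.code, Nat.pair_eq_pair] at h <;> try omega
    rw [ih _ h.2]

/-- Different instances have different codes. -/
theorem ReachInstance.code_injective : Function.Injective ReachInstance.code := by
  rintro ⟨S, ⟨i, p, r, o, t⟩, φ⟩ ⟨S', ⟨i', p', r', o', t'⟩, φ'⟩ h
  simp only [ReachInstance.code, TimedBAT.code, Nat.pair_eq_pair] at h
  obtain ⟨hS, ⟨hi, hp, hr, ho, ht⟩, hφ⟩ := h
  obtain rfl := Signature.code_injective hS
  have hi := List.map_injective_iff.2 (fun x y => Formula.code_injective x y)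
    (Encodable.encode_injective hi)
  have hp : p = p' := funext fun A => Formula.code_injective _ _ (congrFun (codeFn_inj hp) A)
  have hr : r = r' := funext fun A => Formula.code_injective _ _ (congrFun (codeFn_inj hr) A)
  have ho : o = o' := funext fun A => Formula.code_injective _ _ (congrFun (codeFn_inj ho) A)
  have ht : t = t' := funext fun A => Formula.code_injective _ _ (congrFun (codeFn_inj ht) A)
  rw [hi, hp, hr, ho, ht, Formula.code_injective _ _ hφ]

end SitCalc

/-! The halting problem reduces to reachability because the history of a situation is itself an
unbounded memory. Through `occursT`, formulas can ask at which real times an action of a given type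
has occurred, and executability puts no order on these times. So without any fluent a situation
stores two finite sets of reals, one for each of two action types.

The first set generates natural numbers: `natType` is possible at `t` when `t = 0` or when it has
occurred at `t - 1`. This supplies what real arithmetic lacks, quantification over naturals:
requiring that `natType` has occurred at a real makes that real a natural number. The second set
holds facts "code `c` maps `x` to `y`", each stored as one number `triple c x y`: `factType` is
possible at `t` when `t` follows from stored facts by one rule of the evaluation of partial
recursive codes. Executable situations are thus derivations.

Soundness (`occ_sound`) is induction over situations, with `FactCond.evaluates` for a single step.
Completeness (`attainable_of_evaluates`) is induction over derivations: occurrences are never lost,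
so the premises of a rule can be derived one after another. Both hold in every model of the theory,
so `exists_holds_haltQuery` identifies reachability of the query with halting at input `0`. It
remains to see that the theory has a model (`derivModel`), that its models agree on atomic sentences
at the initial situation, and that the instance is computable from the code. -/

namespace SitCalc

open Nat.Partrec (Code)

/-! ### Evaluation of codes as an inductive relation -/

/-- The graph of `Nat.Partrec.Code.eval`, given by closure rules. -/
inductive Evaluates : Code → ℕ → ℕ → Prop
  | zero (x : ℕ) : Evaluates .zero x 0
  | succ (x : ℕ) : Evaluates .succ x (x + 1)
  | left (x y : ℕ) : Evaluates .left (Nat.pair x y) x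
  | right (x y : ℕ) : Evaluates .right (Nat.pair x y) y
  | pair {f g : Code} {x y z : ℕ} : Evaluates f x y → Evaluates g x z →
      Evaluates (.pair f g) x (Nat.pair y z)
  | comp {f g : Code} {x y z : ℕ} : Evaluates g x y → Evaluates f y z →
      Evaluates (.comp f g) x z
  | prec_zero {f : Code} (g : Code) {x y : ℕ} : Evaluates f x y →
      Evaluates (.prec f g) (Nat.pair x 0) y
  | prec_succ {f g : Code} {x n y z : ℕ} : Evaluates (.prec f g) (Nat.pair x n) y →
      Evaluates g (Nat.pair x (Nat.pair n y)) z → Evaluates (.prec f g) (Nat.pair x (n + 1)) z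
  | rfind_zero {f : Code} {x n : ℕ} : Evaluates f (Nat.pair x n) 0 →
      Evaluates (.rfind' f) (Nat.pair x n) n
  | rfind_succ {f : Code} {x n y z : ℕ} : Evaluates f (Nat.pair x n) (y + 1) →
      Evaluates (.rfind' f) (Nat.pair x (n + 1)) z → Evaluates (.rfind' f) (Nat.pair x n) z

/-- Unfolds the unbounded search into its length `k`, the form in which the rules `rfind_zero` and
`rfind_succ` can be matched by induction on `k`. -/
theorem mem_eval_rfind' {f : Code} {x n z : ℕ} : z ∈ (Code.rfind' f).eval (Nat.pair x n) ↔
    ∃ k, z = n + k ∧ 0 ∈ f.eval (Nat.pair x (n + k)) ∧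
      ∀ j < k, ∃ y, y + 1 ∈ f.eval (Nat.pair x (n + j)) := by
  have mem (b : Bool) (j : ℕ) : b ∈ (fun m => m = 0 : ℕ → Bool) <$> f.eval (Nat.pair x (j + n)) ↔
      ∃ y ∈ f.eval (Nat.pair x (n + j)), decide (y = 0) = b := by
    rw [Part.map_eq_map, Part.mem_map_iff, Nat.add_comm]
  simp only [Code.eval, Nat.unpaired, Nat.unpair_pair]
  rw [Part.mem_map_iff]
  constructor
  · rintro ⟨k, hk, rfl⟩
    obtain ⟨h0, h⟩ := Nat.mem_rfind.1 hk
    refine ⟨k, Nat.add_comm _ _, ?_, fun j hj => ?_⟩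
    · obtain ⟨m, hm, h0⟩ := (mem _ _).1 h0
      rwa [of_decide_eq_true h0] at hm
    · obtain ⟨m, hm, h0⟩ := (mem _ _).1 (h hj)
      obtain ⟨y, rfl⟩ := Nat.exists_eq_succ_of_ne_zero (of_decide_eq_false h0)
      exact ⟨y, hm⟩
  · rintro ⟨k, rfl, h0, h⟩
    refine ⟨k, Nat.mem_rfind.2 ⟨(mem _ _).2 ⟨0, h0, rfl⟩, fun {j} hj => ?_⟩, Nat.add_comm _ _⟩
    obtain ⟨y, hy⟩ := h j hj
    exact (mem _ _).2 ⟨y + 1, hy, rfl⟩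

theorem Evaluates.mem_eval {c : Code} {x y : ℕ} (h : Evaluates c x y) : y ∈ c.eval x := by
  induction h with
  | zero | succ | left | right => simp [Code.eval, pure, PFun.pure]
  | pair _ _ h1 h2 => exact Part.mem_bind_iff.2 ⟨_, (Part.mem_map_iff _).2 ⟨_, h1, rfl⟩,
      (Part.mem_map_iff _).2 ⟨_, h2, rfl⟩⟩
  | comp _ _ h1 h2 => exact Part.mem_bind_iff.2 ⟨_, h1, h2⟩
  | prec_zero g _ h => rwa [Code.eval_prec_zero]
  | prec_succ _ _ h1 h2 =>
    rw [← Nat.succ_eq_add_one, Code.eval_prec_succ]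
    exact Part.mem_bind_iff.2 ⟨_, h1, h2⟩
  | rfind_zero _ h => exact mem_eval_rfind'.2 ⟨0, rfl, h, by simp⟩
  | @rfind_succ f x n y z _ _ h1 h2 =>
    obtain ⟨k, rfl, h0, h⟩ := mem_eval_rfind'.1 h2
    refine mem_eval_rfind'.2 ⟨k + 1, by omega, by rwa [Nat.add_assoc, Nat.add_comm 1] at h0,
      fun j hj => ?_⟩
    cases j with
    | zero => exact ⟨y, h1⟩
    | succ j =>
      have := h j (by omega)
      rwa [Nat.add_assoc, Nat.add_comm 1] at this

theorem evaluates_of_mem_eval {c : Code} {x y : ℕ} (h : y ∈ c.eval x) : Evaluates c x y := by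
  induction c generalizing x y with
  | zero =>
    obtain rfl : y = 0 := by simpa [Code.eval, pure, PFun.pure] using h
    exact .zero x
  | succ =>
    obtain rfl : y = x + 1 := by simpa [Code.eval] using h
    exact .succ x
  | left =>
    obtain rfl : y = x.unpair.1 := by simpa [Code.eval] using h
    simpa using Evaluates.left x.unpair.1 x.unpair.2
  | right =>
    obtain rfl : y = x.unpair.2 := by simpa [Code.eval] using h
    simpa using Evaluates.right x.unpair.1 x.unpair.2
  | pair f g hf hg =>
    obtain ⟨_, h1, h2⟩ := Part.mem_bind_iff.1 h
    obtain ⟨a, ha, rfl⟩ := (Part.mem_map_iff _).1 h1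
    obtain ⟨b, hb, rfl⟩ := (Part.mem_map_iff _).1 h2
    exact .pair (hf ha) (hg hb)
  | comp f g hf hg =>
    obtain ⟨a, ha, hb⟩ := Part.mem_bind_iff.1 h
    exact .comp (hg ha) (hf hb)
  | prec f g hf hg =>
    obtain ⟨a, n, rfl⟩ : ∃ a n, x = Nat.pair a n := ⟨_, _, (Nat.pair_unpair x).symm⟩
    induction n generalizing y with
    | zero =>
      rw [Code.eval_prec_zero] at h
      exact .prec_zero g (hf h)
    | succ n ih =>
      rw [← Nat.succ_eq_add_one, Code.eval_prec_succ] at h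
      obtain ⟨b, hb, h⟩ := Part.mem_bind_iff.1 h
      exact .prec_succ (ih hb) (hg h)
  | rfind' f hf =>
    obtain ⟨a, n, rfl⟩ : ∃ a n, x = Nat.pair a n := ⟨_, _, (Nat.pair_unpair x).symm⟩
    obtain ⟨k, rfl, h0, h⟩ := mem_eval_rfind'.1 h
    clear * - hf h0 h
    -- The start `n` must vary: `rfind_succ` moves it up by one while the remaining search length
    -- drops by one.
    induction k generalizing n with
    | zero => exact .rfind_zero (hf h0)
    | succ k ih =>
      obtain ⟨y, hy⟩ := h 0 (by omega)
      refine .rfind_succ (hf hy) ?_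
      have := ih (n + 1) (by rwa [Nat.add_assoc, Nat.add_comm 1]) fun j hj => by
        rw [Nat.add_assoc, Nat.add_comm 1]
        exact h (j + 1) (by omega)
      rwa [Nat.add_assoc, Nat.add_comm 1] at this

/-! ### Arithmetic of pairs and triples over the reals -/

/-- A polynomial whose restriction to triples of natural numbers is injective. -/
def triple {R : Type} [Semiring R] (e x y : R) : R :=
  let p := (x + y) * (x + y) + x
  (e + p) * (e + p) + e

@[simp, norm_cast]
theorem cast_triple (e x y : ℕ) : ((triple e x y : ℕ) : ℝ) = triple (e : ℝ) x y := by
  simp [triple]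

/-- Since `a ≤ a + b`, the value lies in `[(a + b)², (a + b + 1)²)`, so it determines `a + b`, and
then `a`. -/
theorem polyPair_inj {a b c d : ℕ} (h : (a + b) * (a + b) + a = (c + d) * (c + d) + c) :
    a = c ∧ b = d := by
  have h1 : a + b = c + d := by
    rcases lt_trichotomy (a + b) (c + d) with h1 | h1 | h1
    · nlinarith
    · exact h1
    · nlinarith
  rw [h1] at h
  omega

theorem triple_inj {e x y e' x' y' : ℕ}
    (h : triple (e : ℝ) (x : ℝ) (y : ℝ) = triple (e' : ℝ) (x' : ℝ) (y' : ℝ)) :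
    e = e' ∧ x = x' ∧ y = y' := by
  have h : triple e x y = triple e' x' y' := by exact_mod_cast h
  obtain ⟨h1, h2⟩ := polyPair_inj h
  exact ⟨h1, polyPair_inj h2⟩

/-- The graph of `Nat.pair`, extended to the reals. -/
def IsPair (x y z : ℝ) : Prop :=
  x < y ∧ z = y * y + x ∨ ¬ x < y ∧ z = x * x + x + y

theorem isPair_natCast {a b : ℕ} {z : ℝ} : IsPair a b z ↔ z = (Nat.pair a b : ℕ) := by
  unfold IsPair Nat.pair
  by_cases h : a < b <;> simp [h]

/-- The rules that define `Evaluates`, as conditions on the number `t` of a fact. -/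
def FactCases (F : ℝ → Prop) (t f g a b u v h c d k : ℝ) : Prop :=
  -- The first components follow `Code.encodeCode`: 0 to 3 for the basic codes, then `4h + 4`, `4h +
  -- 6`, `4h + 5` and `4f + 7` for `pair`, `comp`, `prec` and `rfind'`. Intended values: `h` pairs
  -- `f, g`; `c` pairs `a, b`; `d` pairs `a, b + 1`; `k` pairs `a` with the pair of `b, u`.
  t = triple 0 a 0 ∨ t = triple 1 a (a + 1) ∨ t = triple 2 c a ∨ t = triple 3 c b ∨
  (F (triple f u a) ∧ F (triple g u b) ∧ t = triple (4 * h + 4) u c) ∨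
  (F (triple g u a) ∧ F (triple f a b) ∧ t = triple (4 * h + 6) u b) ∨
  (F (triple f a u) ∧ b = 0 ∧ t = triple (4 * h + 5) c u) ∨
  (F (triple (4 * h + 5) c u) ∧ F (triple g k v) ∧ t = triple (4 * h + 5) d v) ∨
  (F (triple f c 0) ∧ t = triple (4 * f + 7) c b) ∨
  (F (triple f c (v + 1)) ∧ F (triple (4 * f + 7) d u) ∧ t = triple (4 * f + 7) c u)

/-- `t` is the number of a fact that follows from facts with numbers in `F` by one rule, where
`N` is the set of available natural numbers. -/
def FactCond (N F : ℝ → Prop) (t : ℝ) : Prop :=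
  ∃ w : Fin 11 → ℝ,
    -- Only the first six witnesses need a guard: the other five are determined by them through
    -- `IsPair`.
    (N (w 0) ∧ N (w 1) ∧ N (w 2) ∧ N (w 3) ∧ N (w 4) ∧ N (w 5)) ∧
    (IsPair (w 0) (w 1) (w 6) ∧ IsPair (w 2) (w 3) (w 7) ∧ IsPair (w 2) (w 3 + 1) (w 8) ∧
      IsPair (w 3) (w 4) (w 9) ∧ IsPair (w 2) (w 9) (w 10)) ∧
    FactCases F t (w 0) (w 1) (w 2) (w 3) (w 4) (w 5) (w 6) (w 7) (w 8) (w 10)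

def NatCond (N : ℝ → Prop) (t : ℝ) : Prop := t = 0 ∨ N (t - 1)

theorem factCond_of_cases {N F : ℝ → Prop} {t : ℝ} (f g a b u v : ℕ)
    (hf : N f) (hg : N g) (ha : N a) (hb : N b) (hu : N u) (hv : N v)
    (h : FactCases F t f g a b u v (Nat.pair f g : ℕ) (Nat.pair a b : ℕ)
      (Nat.pair a (b + 1) : ℕ) (Nat.pair a (Nat.pair b u) : ℕ)) : FactCond N F t := by
  refine ⟨![f, g, a, b, u, v, (Nat.pair f g : ℕ), (Nat.pair a b : ℕ), (Nat.pair a (b + 1) : ℕ),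
    (Nat.pair b u : ℕ), (Nat.pair a (Nat.pair b u) : ℕ)], ⟨hf, hg, ha, hb, hu, hv⟩,
    ⟨isPair_natCast.2 rfl, isPair_natCast.2 rfl, ?_, isPair_natCast.2 rfl,
      isPair_natCast.2 rfl⟩, h⟩
  have := (isPair_natCast (a := a) (b := b + 1)).2 rfl
  rwa [Nat.cast_succ] at this

theorem FactCond.cases {N F : ℝ → Prop} {t : ℝ} (hN : ∀ r, N r → ∃ n : ℕ, r = n)
    (h : FactCond N F t) : ∃ f g a b u v : ℕ,
      FactCases F t f g a b u v (Nat.pair f g : ℕ) (Nat.pair a b : ℕ)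
        (Nat.pair a (b + 1) : ℕ) (Nat.pair a (Nat.pair b u) : ℕ) := by
  obtain ⟨w, ⟨h0, h1, h2, h3, h4, h5⟩, ⟨p1, p2, p3, p4, p5⟩, h⟩ := h
  obtain ⟨f, hf⟩ := hN _ h0
  obtain ⟨g, hg⟩ := hN _ h1
  obtain ⟨a, ha⟩ := hN _ h2
  obtain ⟨b, hb⟩ := hN _ h3
  obtain ⟨u, hu⟩ := hN _ h4
  obtain ⟨v, hv⟩ := hN _ h5
  rw [hf, hg] at p1
  rw [ha, hb] at p2
  rw [ha, hb, ← Nat.cast_succ] at p3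
  rw [hb, hu] at p4
  rw [isPair_natCast] at p1 p2 p3 p4
  rw [ha, p4, isPair_natCast] at p5
  rw [hf, hg, ha, hb, hu, hv, p1, p2, p3, p5] at h
  exact ⟨f, g, a, b, u, v, h⟩

/-- Soundness of one step. The guards make all witnesses natural, so `triple_inj` decodes the
premises; and every natural number is the number of a code, so `f` and `g` need no further check. -/
theorem FactCond.evaluates {N F : ℝ → Prop} {t : ℝ} (hN : ∀ r, N r → ∃ n : ℕ, r = n)
    (hF : ∀ r, F r → ∃ (c : Code) (x y : ℕ), r = triple (c.encodeCode : ℝ) x y ∧ Evaluates c x y)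
    (h : FactCond N F t) :
    ∃ (c : Code) (x y : ℕ), t = triple (c.encodeCode : ℝ) x y ∧ Evaluates c x y := by
  have key {c : Code} {x y : ℕ} (h : F (triple (c.encodeCode : ℝ) x y)) : Evaluates c x y := by
    obtain ⟨c', x', y', h1, h2⟩ := hF _ h
    obtain ⟨hc, rfl, rfl⟩ := triple_inj h1
    obtain rfl : c = c' := Encodable.encode_injective hc
    exact h2
  have code (n : ℕ) : ∃ c : Code, n = c.encodeCode :=
    ⟨Denumerable.ofNat Code n, by rw [← Code.encodeCode_eq, Denumerable.encode_ofNat]⟩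
  obtain ⟨m, n, a, b, u, v, h⟩ := h.cases hN
  obtain ⟨f, rfl⟩ := code m
  obtain ⟨g, rfl⟩ := code n
  have hcomp : 4 * (Nat.pair f.encodeCode g.encodeCode : ℝ) + 6
      = ((Code.comp f g).encodeCode : ℕ) := by
    simp only [Code.encodeCode]; push_cast; ring
  have hpair : 4 * (Nat.pair f.encodeCode g.encodeCode : ℝ) + 4
      = ((Code.pair f g).encodeCode : ℕ) := by
    simp only [Code.encodeCode]; push_cast; ring
  have hprec : 4 * (Nat.pair f.encodeCode g.encodeCode : ℝ) + 5
      = ((Code.prec f g).encodeCode : ℕ) := by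
    simp only [Code.encodeCode]; push_cast; ring
  have hrfind : 4 * (f.encodeCode : ℝ) + 7 = ((Code.rfind' f).encodeCode : ℕ) := by
    simp only [Code.encodeCode]; push_cast; ring
  rw [FactCases, hcomp, hpair, hprec, hrfind] at h
  rcases h with h | h | h | h | ⟨h1, h2, h⟩ | ⟨h1, h2, h⟩ | ⟨h1, hb, h⟩ | ⟨h1, h2, h⟩ |
    ⟨h1, h⟩ | ⟨h1, h2, h⟩
  · exact ⟨_, _, _, by simpa [Code.encodeCode] using h, .zero a⟩
  · exact ⟨_, _, _, by simpa [Code.encodeCode] using h, .succ a⟩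
  · exact ⟨_, _, _, by simpa [Code.encodeCode] using h, .left a b⟩
  · exact ⟨_, _, _, by simpa [Code.encodeCode] using h, .right a b⟩
  · exact ⟨_, _, _, h, .pair (key h1) (key h2)⟩
  · exact ⟨_, _, _, h, .comp (key h1) (key h2)⟩
  · obtain rfl : b = 0 := by exact_mod_cast hb
    exact ⟨_, _, _, h, .prec_zero g (key h1)⟩
  · exact ⟨_, _, _, h, .prec_succ (key h1) (key h2)⟩
  · rw [← Nat.cast_zero] at h1
    exact ⟨_, _, _, h, .rfind_zero (key h1)⟩
  · rw [← Nat.cast_succ] at h1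
    exact ⟨_, _, _, h, .rfind_succ (key h1) (key h2)⟩

end SitCalc

namespace SitCalc

/-! ### Formulas -/

section Formulas

variable {S : Signature} {o t a : ℕ}

def Formula.and (p q : Formula S o t a) : Formula S o t a := (p.imp q.neg).neg

def Formula.or (p q : Formula S o t a) : Formula S o t a := p.neg.imp q

def Formula.exTimes : (k : ℕ) → Formula S o (t + k) a → Formula S o t a
  | 0, p => p
  | k + 1, p => exTimes k (.neg (.allTime p.neg))

def Formula.isPair (x y z : Term S o t a .time) : Formula S o t a :=
  .or (.and (.lt x y) (.eqTime z (.add (.mul y y) x)))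
    (.and (.neg (.lt x y)) (.eqTime z (.add (.add (.mul x x) x) y)))

def Term.polyPair (x y : Term S o t a .time) : Term S o t a .time :=
  .add (.mul (.add x y) (.add x y)) x

def Term.triple (e x y : Term S o t a .time) : Term S o t a .time :=
  .polyPair e (.polyPair x y)

variable (M : Interp S) (s : M.Sit) (vo : Fin o → M.Obj) (vt : Fin t → ℝ) (va : Fin a → M.Act)

@[simp]
theorem Interp.sat_neg (p : Formula S o t a) : M.Sat s vo vt va p.neg ↔ ¬ M.Sat s vo vt va p :=
  Iff.rfl

@[simp]
theorem Interp.sat_and (p q : Formula S o t a) :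
    M.Sat s vo vt va (p.and q) ↔ M.Sat s vo vt va p ∧ M.Sat s vo vt va q := by
  simp [Formula.and, Interp.Sat]

@[simp]
theorem Interp.sat_or (p q : Formula S o t a) :
    M.Sat s vo vt va (p.or q) ↔ M.Sat s vo vt va p ∨ M.Sat s vo vt va q := by
  simp only [Formula.or, Interp.Sat, Interp.sat_neg]
  tauto

theorem Interp.sat_exTimes (k : ℕ) (p : Formula S o (t + k) a) :
    M.Sat s vo vt va (p.exTimes k) ↔
      ∃ w : Fin k → ℝ, M.Sat s vo (Fin.append vt w) va p := by
  induction k with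
  | zero =>
    have (w : Fin 0 → ℝ) : Fin.append vt w = vt := by
      rw [Subsingleton.elim w Fin.elim0, Fin.append_elim0]; rfl
    simp [Formula.exTimes, this]
  | succ k ih =>
    simp only [Formula.exTimes, ih, Interp.sat_neg, Interp.Sat, not_forall, not_not]
    constructor
    · rintro ⟨w, d, h⟩
      refine ⟨Fin.snoc w d, ?_⟩
      rwa [Fin.append_snoc]
    · rintro ⟨w, h⟩
      refine ⟨Fin.init w, w (Fin.last k), ?_⟩
      rwa [← Fin.append_snoc, Fin.snoc_init_self]

@[simp]
theorem Interp.sat_eqTime (x y : Term S o t a .time) : M.Sat s vo vt va (.eqTime x y) ↔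
    (M.eval s vo vt va x : ℝ) = (M.eval s vo vt va y : ℝ) := Iff.rfl

@[simp]
theorem Interp.sat_lt (x y : Term S o t a .time) : M.Sat s vo vt va (.lt x y) ↔
    (M.eval s vo vt va x : ℝ) < (M.eval s vo vt va y : ℝ) := Iff.rfl

@[simp]
theorem Interp.eval_add (x y : Term S o t a .time) : (M.eval s vo vt va (.add x y) : ℝ) =
    (M.eval s vo vt va x : ℝ) + (M.eval s vo vt va y : ℝ) := rfl

@[simp]
theorem Interp.eval_sub (x y : Term S o t a .time) : (M.eval s vo vt va (.sub x y) : ℝ) =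
    (M.eval s vo vt va x : ℝ) - (M.eval s vo vt va y : ℝ) := rfl

@[simp]
theorem Interp.eval_mul (x y : Term S o t a .time) : (M.eval s vo vt va (.mul x y) : ℝ) =
    (M.eval s vo vt va x : ℝ) * (M.eval s vo vt va y : ℝ) := rfl

@[simp]
theorem Interp.eval_num (n : ℕ) : (M.eval s vo vt va (.num n) : ℝ) = n := rfl

@[simp]
theorem Interp.eval_timeVar (i : Fin t) : (M.eval s vo vt va (.timeVar i) : ℝ) = vt i := rfl

@[simp]
theorem Interp.sat_isPair (x y z : Term S o t a .time) : M.Sat s vo vt va (.isPair x y z) ↔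
    IsPair (M.eval s vo vt va x) (M.eval s vo vt va y) (M.eval s vo vt va z) := by
  simp [Formula.isPair, IsPair]

@[simp]
theorem Interp.eval_triple (x y z : Term S o t a .time) :
    (M.eval s vo vt va (.triple x y z) : ℝ) = SitCalc.triple (R := ℝ)
    (M.eval s vo vt va x) (M.eval s vo vt va y) (M.eval s vo vt va z) := rfl

end Formulas

/-! ### The theory -/

/-- One object, and two action types whose only argument is a time. -/
def derivSig : Signature where
  numObj := 1
  actions := [0, 0]
  relFluents := []
  objFluents := []
  timeFluents := []
  rigidRels := []
  rigidObjFuns := []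
  rigidTimeFuns := []

/-- The action type whose occurrence at `t` makes the natural number `t` available. -/
def natType : Fin derivSig.actions.length := (0 : Fin 2)

/-- The action type whose occurrence at `t` derives the fact with number `t`. -/
def factType : Fin derivSig.actions.length := (1 : Fin 2)

section Theory

variable {o t a : ℕ}

/-- The action of type `A` at time `x` has occurred. -/
def Formula.occ (A : Fin derivSig.actions.length) (x : Term derivSig o t a .time) :
    Formula derivSig o t a :=
  -- Both action types have no object argument; the constant family fills the empty tuple without a
  -- case distinction on `A`.
  .occursT (.act A (fun _ => .const (0 : Fin 1)) x) x

def Formula.natCond : Formula derivSig o 1 a :=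
  .or (.eqTime (.timeVar 0) (.num 0)) (.occ natType (.sub (.timeVar 0) (.num 1)))

def Term.succTime (x : Term derivSig o t a .time) : Term derivSig o t a .time :=
  .add x (.num 1)

def Formula.factCases (t f g a b u v h c d k : Term derivSig o 12 0 .time) :
    Formula derivSig o 12 0 :=
  let F := Formula.occ factType
  let hPair := Term.add (.mul (.num 4) h) (.num 4)
  let hComp := Term.add (.mul (.num 4) h) (.num 6)
  let hPrec := Term.add (.mul (.num 4) h) (.num 5)
  let fRfind := Term.add (.mul (.num 4) f) (.num 7)
  .or (.eqTime t (.triple (.num 0) a (.num 0))) <|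
  .or (.eqTime t (.triple (.num 1) a a.succTime)) <|
  .or (.eqTime t (.triple (.num 2) c a)) <|
  .or (.eqTime t (.triple (.num 3) c b)) <|
  .or (.and (F (.triple f u a)) (.and (F (.triple g u b)) (.eqTime t (.triple hPair u c)))) <|
  .or (.and (F (.triple g u a)) (.and (F (.triple f a b)) (.eqTime t (.triple hComp u b)))) <|
  .or (.and (F (.triple f a u)) (.and (.eqTime b (.num 0)) (.eqTime t (.triple hPrec c u)))) <|
  .or (.and (F (.triple hPrec c u)) (.and (F (.triple g k v)) (.eqTime t (.triple hPrec d v)))) <|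
  .or (.and (F (.triple f c (.num 0))) (.eqTime t (.triple fRfind c b)))
    (.and (F (.triple f c v.succTime))
      (.and (F (.triple fRfind d u)) (.eqTime t (.triple fRfind c u))))

def Formula.factCond : Formula derivSig o 1 0 :=
  -- Of the `12 = 1 + 11` time variables, the first is the time of the action and the others are the
  -- bound witnesses.
  let w (i : Fin 11) : Term derivSig o 12 0 .time := .timeVar (Fin.natAdd 1 i)
  let N := Formula.occ natType
  Formula.exTimes 11 <|
    .and (.and (N (w 0)) (.and (N (w 1)) (.and (N (w 2)) (.and (N (w 3))
      (.and (N (w 4)) (N (w 5))))))) <|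
    .and (.and (.isPair (w 0) (w 1) (w 6)) (.and (.isPair (w 2) (w 3) (w 7))
      (.and (.isPair (w 2) (w 3).succTime (w 8)) (.and (.isPair (w 3) (w 4) (w 9))
        (.isPair (w 2) (w 9) (w 10)))))) <|
    .factCases (.timeVar (Fin.castAdd 11 0)) (w 0) (w 1) (w 2) (w 3) (w 4) (w 5) (w 6) (w 7) (w 8)
      (w 10)

/-- The theory whose executable situations are the derivations of facts about evaluation. -/
def derivBAT : TimedBAT derivSig where
  -- Needed for complete information: the start of the initial situation would otherwise be
  -- undetermined.
  initial := [.eqTime .start (.num 0)]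
  poss A := if A = natType then .natCond else .factCond
  ssaRel F := Fin.elim0 F
  ssaObj f := Fin.elim0 f
  ssaTime f := Fin.elim0 f

/-- The code with number `n` evaluates to some value at `0`. -/
def haltQuery (n : ℕ) : Sentence derivSig :=
  -- `w 0` stands for `n`, so that the numeral occurs only once and the rest of the formula does not
  -- depend on `n`. The output `w 1` is guarded by `natType` because `triple` is injective only on
  -- naturals.
  let w (i : Fin 2) : Term derivSig 0 2 0 .time := .timeVar (Fin.natAdd 0 i)
  Formula.exTimes 2 <| .and (.eqTime (w 0) (.num n)) <|
    .and (.occ natType (w 1)) (.occ factType (.triple (w 0) (.num 0) (w 1)))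

variable (M : Interp derivSig)

/-- The action of type `A` at time `r` has occurred on the way to `s`. -/
def Interp.Occ (s : M.Sit) (A : Fin derivSig.actions.length) (r : ℝ) : Prop :=
  M.OccursT (M.act A (fun _ => M.const (0 : Fin 1)) r) r s

variable (s : M.Sit) (vo : Fin o → M.Obj) (vt : Fin t → ℝ) (va : Fin a → M.Act)

@[simp]
theorem Interp.sat_occ (A : Fin derivSig.actions.length) (x : Term derivSig o t a .time) :
    M.Sat s vo vt va (.occ A x) ↔ M.Occ s A (M.eval s vo vt va x) := Iff.rfl

@[simp]
theorem Interp.eval_succTime (x : Term derivSig o t a .time) :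
    (M.eval s vo vt va x.succTime : ℝ) = (M.eval s vo vt va x : ℝ) + 1 := by
  simp [Term.succTime]

theorem Interp.sat_natCond (τ : ℝ) :
    M.Sat s vo (fun _ => τ) va .natCond ↔ NatCond (M.Occ s natType) τ := by
  simp [Formula.natCond, NatCond]

theorem Interp.sat_factCases (vt : Fin 12 → ℝ) (va : Fin 0 → M.Act)
    (t f g a b u v h c d k : Term derivSig o 12 0 .time) :
    M.Sat s vo vt va (.factCases t f g a b u v h c d k) ↔
    FactCases (M.Occ s factType) (M.eval s vo vt va t) (M.eval s vo vt va f) (M.eval s vo vt va g)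
      (M.eval s vo vt va a) (M.eval s vo vt va b) (M.eval s vo vt va u) (M.eval s vo vt va v)
      (M.eval s vo vt va h) (M.eval s vo vt va c) (M.eval s vo vt va d)
      (M.eval s vo vt va k) := by
  simp [Formula.factCases, FactCases]

theorem Interp.sat_factCond (τ : ℝ) (va : Fin 0 → M.Act) :
    M.Sat s vo (fun _ => τ) va .factCond ↔
      FactCond (M.Occ s natType) (M.Occ s factType) τ := by
  simp only [Formula.factCond, Interp.sat_exTimes, Interp.sat_and, Interp.sat_occ,
    Interp.sat_isPair, Interp.sat_factCases, Interp.eval_timeVar, Interp.eval_succTime,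
    Fin.append_right, Fin.append_left, FactCond]

theorem Interp.holds_haltQuery (n : ℕ) : M.Holds s (haltQuery n) ↔
    ∃ y, M.Occ s natType y ∧ M.Occ s factType (triple (n : ℝ) 0 y) := by
  simp only [Interp.Holds, haltQuery, Interp.sat_exTimes, Interp.sat_and, Interp.sat_occ,
    Interp.sat_eqTime, Interp.eval_triple, Interp.eval_timeVar, Interp.eval_num, Fin.append_right,
    Nat.cast_zero]
  constructor
  · rintro ⟨w, h0, h⟩
    exact ⟨w 1, by rwa [h0] at h⟩
  · rintro ⟨y, h⟩
    exact ⟨![n, y], rfl, h⟩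

end Theory

end SitCalc

namespace SitCalc

open Nat.Partrec (Code)

/-! ### Occurrences and executability in models -/

theorem forall_mem_pair {α : Type} {p : α → Prop} {a b : α} :
    (∀ x ∈ [a, b], p x) ↔ p a ∧ p b := by
  simp

namespace Interp

section Foundations

variable {S : Signature} {M : Interp S} (hM : M.Foundational)
include hM

theorem Foundational.before_doAct_self (α : M.Act) (s : M.Sit) : M.before s (M.doAct α s) :=
  (hM.before_doAct _ _ _).2 (.inr rfl)

theorem Foundational.doAct_ne_s0 (α : M.Act) (s : M.Sit) : M.doAct α s ≠ M.s0 := fun h =>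
  hM.not_before_s0 s (h ▸ hM.before_doAct_self α s)

theorem Foundational.not_beforeEq_s0 (α : M.Act) (s : M.Sit) :
    ¬ M.beforeEq (M.doAct α s) M.s0 := by
  rintro (h | h)
  · exact hM.not_before_s0 _ h
  · exact hM.doAct_ne_s0 _ _ h

theorem Foundational.beforeEq_doAct (α : M.Act) (s s' : M.Sit) :
    M.beforeEq s (M.doAct α s') ↔ M.beforeEq s s' ∨ s = M.doAct α s' := by
  rw [beforeEq, hM.before_doAct]

theorem Foundational.not_occursT_s0 (α : M.Act) (τ : ℝ) : ¬ M.OccursT α τ M.s0 := by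
  rintro ⟨s, h, -⟩
  exact hM.not_beforeEq_s0 _ _ h

theorem Foundational.occursT_doAct (α β : M.Act) (τ : ℝ) (s : M.Sit) :
    M.OccursT α τ (M.doAct β s) ↔ (α = β ∧ M.time β = τ) ∨ M.OccursT α τ s := by
  simp only [OccursT, hM.beforeEq_doAct]
  constructor
  · rintro ⟨s', h | h, hs⟩
    · exact .inr ⟨s', h, hs⟩
    · refine .inl ⟨(hM.doAct_inj _ _ _ _ h).1, ?_⟩
      rw [← hs, h, hM.start_doAct]
  · rintro (⟨rfl, rfl⟩ | ⟨s', h, hs⟩)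
    · exact ⟨s, .inr rfl, hM.start_doAct _ _⟩
    · exact ⟨s', .inl h, hs⟩

theorem Foundational.exec_s0 : M.Exec M.s0 := fun _ _ h => (hM.not_beforeEq_s0 _ _ h).elim

theorem Foundational.exec_doAct (α : M.Act) (s : M.Sit) :
    M.Exec (M.doAct α s) ↔ M.poss α s ∧ M.Exec s := by
  simp only [Exec, hM.beforeEq_doAct]
  constructor
  · exact fun h => ⟨h _ _ (.inr rfl), fun β s' hs => h β s' (.inl hs)⟩
  · rintro ⟨h, hs⟩ β s' (h' | h')
    · exact hs _ _ h'
    · obtain ⟨rfl, rfl⟩ := hM.doAct_inj _ _ _ _ h'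
      exact h

end Foundations

/-! ### Executable situations as derivations: soundness and completeness -/

section Derivations

variable {M : Interp derivSig}

/-- An executable situation can be continued to one where the action of type `A` has occurred
at time `r`. -/
def Attainable (M : Interp derivSig) (A : Fin derivSig.actions.length) (r : ℝ) : Prop :=
  ∀ s, M.Exec s → ∃ s', M.Exec s' ∧ (∀ B q, M.Occ s B q → M.Occ s' B q) ∧ M.Occ s' A r

/-- Finitely many attainable occurrences are jointly attainable. -/
theorem attain_list (l : List (Fin derivSig.actions.length × ℝ))
    (hl : ∀ p ∈ l, M.Attainable p.1 p.2) (s : M.Sit) (hs : M.Exec s) :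
    ∃ s', M.Exec s' ∧ (∀ B q, M.Occ s B q → M.Occ s' B q) ∧ ∀ p ∈ l, M.Occ s' p.1 p.2 := by
  induction l with
  | nil => exact ⟨s, hs, fun _ _ h => h, by simp⟩
  | cons p l ih =>
    obtain ⟨s1, hs1, hle1, h1⟩ := ih fun q hq => hl q (List.mem_cons_of_mem _ hq)
    obtain ⟨s2, hs2, hle2, h2⟩ := hl p List.mem_cons_self s1 hs1
    refine ⟨s2, hs2, fun B q h => hle2 _ _ (hle1 _ _ h), fun q hq => ?_⟩
    rcases List.mem_cons.1 hq with rfl | hq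
    · exact h2
    · exact hle2 _ _ (h1 q hq)

variable (hM : M.IsModel derivBAT)
include hM

/-- Domain closure leaves a single object, so an action is determined by its type and its time. -/
theorem IsModel.args_eq {n : ℕ} (x y : Fin n → M.Obj) : x = y := by
  have (d : M.Obj) : d = M.const (0 : Fin 1) := by
    obtain ⟨c, rfl⟩ := hM.names.const_surj d
    exact congrArg M.const (Subsingleton.elim (α := Fin 1) _ _)
  funext i
  rw [this (x i), this (y i)]

theorem IsModel.not_occ_s0 (A : Fin derivSig.actions.length) (r : ℝ) : ¬ M.Occ M.s0 A r :=
  hM.foundational.not_occursT_s0 _ _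

theorem IsModel.occ_doAct (A B : Fin derivSig.actions.length) (x) (r τ : ℝ) (s : M.Sit) :
    M.Occ (M.doAct (M.act B x τ) s) A r ↔ (A = B ∧ r = τ) ∨ M.Occ s A r := by
  rw [Occ, Occ, hM.foundational.occursT_doAct, hM.foundational.time_act]
  refine or_congr_left ⟨fun h => ⟨?_, h.2.symm⟩, ?_⟩
  · by_contra hne
    exact hM.names.act_ne _ _ _ _ _ _ hne h.1
  · rintro ⟨rfl, rfl⟩
    exact ⟨congrArg (M.act A · r) (hM.args_eq _ _), rfl⟩

theorem IsModel.poss_nat (x) (τ : ℝ) (s : M.Sit) :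
    M.poss (M.act natType x τ) s ↔ NatCond (M.Occ s natType) τ :=
  (hM.poss _ _ _ _).trans (M.sat_natCond s x Fin.elim0 τ)

theorem IsModel.poss_fact (x) (τ : ℝ) (s : M.Sit) :
    M.poss (M.act factType x τ) s ↔ FactCond (M.Occ s natType) (M.Occ s factType) τ :=
  (hM.poss _ _ _ _).trans (M.sat_factCond s x τ Fin.elim0)

/-- Induction over situations: the last action was possible before it was performed, so its time
arises by one counting step or one rule from occurrences already known to be sound. -/
theorem IsModel.occ_sound : ∀ s : M.Sit, M.Exec s →
    (∀ r, M.Occ s natType r → ∃ n : ℕ, r = n) ∧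
    ∀ r, M.Occ s factType r →
      ∃ (c : Code) (x y : ℕ), r = triple (c.encodeCode : ℝ) x y ∧ Evaluates c x y := by
  refine hM.foundational.induction _ (fun _ => ⟨fun r h => (hM.not_occ_s0 _ _ h).elim,
    fun r h => (hM.not_occ_s0 _ _ h).elim⟩) (fun α s ih hs => ?_)
  obtain ⟨hp, hs⟩ := (hM.foundational.exec_doAct _ _).1 hs
  obtain ⟨hN, hF⟩ := ih hs
  obtain ⟨A, x, τ, rfl⟩ := hM.names.act_closure α
  simp only [hM.occ_doAct]
  constructor
  · rintro r (⟨rfl, rfl⟩ | h)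
    · rcases (hM.poss_nat _ _ _).1 hp with rfl | h
      · exact ⟨0, by simp⟩
      · obtain ⟨n, hn⟩ := hN _ h
        exact ⟨n + 1, by push_cast; linarith⟩
    · exact hN r h
  · rintro r (⟨rfl, rfl⟩ | h)
    · exact ((hM.poss_fact _ _ _).1 hp).evaluates hN hF
    · exact hF r h

theorem IsModel.attainable_step {A : Fin derivSig.actions.length} {r : ℝ} {s s' : M.Sit}
    (hs : M.Exec s') (hle : ∀ B q, M.Occ s B q → M.Occ s' B q)
    (hp : M.poss (M.act A (fun _ => M.const (0 : Fin 1)) r) s') :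
    ∃ s', M.Exec s' ∧ (∀ B q, M.Occ s B q → M.Occ s' B q) ∧ M.Occ s' A r :=
  ⟨_, (hM.foundational.exec_doAct _ _).2 ⟨hp, hs⟩,
    fun B q h => (hM.occ_doAct _ _ _ _ _ _).2 (.inr (hle B q h)),
    (hM.occ_doAct _ _ _ _ _ _).2 (.inl ⟨rfl, rfl⟩)⟩

/-- Counting up from `0` works after any executable situation, since actions may be repeated and
their times need not increase. -/
theorem IsModel.attainable_nat (n : ℕ) : M.Attainable natType n := by
  induction n with
  | zero =>
    intro s hs
    exact hM.attainable_step hs (fun _ _ h => h) ((hM.poss_nat _ _ _).2 (.inl Nat.cast_zero))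
  | succ n ih =>
    intro s hs
    obtain ⟨s', hs', hle, h⟩ := ih s hs
    exact hM.attainable_step hs' hle ((hM.poss_nat _ _ _).2 (.inr (by simpa using h)))

/-- One rule with premises `l`: first the six numbers are generated, then the premises are derived,
then the rule is applied. The situation reached is not known in advance, so `h` is required for
every `F` that contains the premises. -/
theorem IsModel.attainable_fact {r : ℝ} (l : List ℝ) (hl : ∀ q ∈ l, M.Attainable factType q)
    (f g a b u v : ℕ)
    (h : ∀ F : ℝ → Prop, (∀ q ∈ l, F q) → FactCases F r f g a b u v (Nat.pair f g : ℕ)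
      (Nat.pair a b : ℕ) (Nat.pair a (b + 1) : ℕ) (Nat.pair a (Nat.pair b u) : ℕ)) :
    M.Attainable factType r := by
  intro s hs
  obtain ⟨s1, hs1, hle1, h1⟩ := attain_list
    ([f, g, a, b, u, v].map fun n : ℕ => (natType, (n : ℝ)))
    (by
      intro p hp
      obtain ⟨n, -, rfl⟩ := List.mem_map.1 hp
      exact hM.attainable_nat n) s hs
  obtain ⟨s2, hs2, hle2, h2⟩ := attain_list (l.map fun q => (factType, q))
    (by
      intro p hp
      obtain ⟨q, hq, rfl⟩ := List.mem_map.1 hp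
      exact hl q hq) s1 hs1
  have hN (n : ℕ) (hn : n ∈ [f, g, a, b, u, v]) : M.Occ s2 natType n :=
    hle2 _ _ (h1 _ (List.mem_map.2 ⟨n, hn, rfl⟩))
  refine hM.attainable_step hs2 (fun B q hq => hle2 _ _ (hle1 _ _ hq))
    ((hM.poss_fact _ _ _).2 (factCond_of_cases f g a b u v (hN f ?_) (hN g ?_) (hN a ?_)
      (hN b ?_) (hN u ?_) (hN v ?_) (h _ fun q hq => h2 _ (List.mem_map.2 ⟨q, hq, rfl⟩))))
  all_goals simp

theorem IsModel.attainable_of_evaluates {c : Code} {x y : ℕ} (h : Evaluates c x y) :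
    M.Attainable factType (triple (c.encodeCode : ℝ) x y) := by
  have hcomp (f g : Code) : ((Code.comp f g).encodeCode : ℝ) =
      4 * (Nat.pair f.encodeCode g.encodeCode : ℝ) + 6 := by
    simp only [Code.encodeCode]; push_cast; ring
  have hpair (f g : Code) : ((Code.pair f g).encodeCode : ℝ) =
      4 * (Nat.pair f.encodeCode g.encodeCode : ℝ) + 4 := by
    simp only [Code.encodeCode]; push_cast; ring
  have hprec (f g : Code) : ((Code.prec f g).encodeCode : ℝ) =
      4 * (Nat.pair f.encodeCode g.encodeCode : ℝ) + 5 := by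
    simp only [Code.encodeCode]; push_cast; ring
  have hrfind (f : Code) : ((Code.rfind' f).encodeCode : ℝ) = 4 * (f.encodeCode : ℝ) + 7 := by
    simp only [Code.encodeCode]; push_cast; ring
  induction h with
  | zero x =>
    -- Here and below, slots that the rule does not use are filled with `0`.
    refine hM.attainable_fact [] (by simp) 0 0 x 0 0 0 fun F _ => .inl ?_
    simp [Code.encodeCode]
  | succ x =>
    refine hM.attainable_fact [] (by simp) 0 0 x 0 0 0 fun F _ => .inr <| .inl ?_
    simp [Code.encodeCode]
  | left x y =>
    refine hM.attainable_fact [] (by simp) 0 0 x y 0 0 fun F _ => .inr <| .inr <| .inl ?_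
    simp [Code.encodeCode]
  | right x y =>
    refine hM.attainable_fact [] (by simp) 0 0 x y 0 0 fun F _ => .inr <| .inr <| .inr <| .inl ?_
    simp [Code.encodeCode]
  | @pair f g x y z _ _ h1 h2 =>
    refine hM.attainable_fact [_, _] (forall_mem_pair.2 ⟨h1, h2⟩)
      -- The slots `a, b` are the two outputs, which get paired, and `u` is the common input.
      f.encodeCode g.encodeCode y z x 0 fun F hF => ?_
    obtain ⟨h1, h2⟩ := forall_mem_pair.1 hF
    rw [hpair]
    exact .inr <| .inr <| .inr <| .inr <| .inl ⟨h1, h2, rfl⟩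
  | @comp f g x y z _ _ h1 h2 =>
    refine hM.attainable_fact [_, _] (forall_mem_pair.2 ⟨h1, h2⟩)
      f.encodeCode g.encodeCode y z x 0 fun F hF => ?_
    obtain ⟨h1, h2⟩ := forall_mem_pair.1 hF
    rw [hcomp]
    exact .inr <| .inr <| .inr <| .inr <| .inr <| .inl ⟨h1, h2, rfl⟩
  | @prec_zero f g x y _ h1 =>
    refine hM.attainable_fact [_] (List.forall_mem_singleton.2 h1)
      f.encodeCode g.encodeCode x 0 y 0 fun F hF => ?_
    rw [hprec]
    exact .inr <| .inr <| .inr <| .inr <| .inr <| .inr <| .inl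
      ⟨List.forall_mem_singleton.1 hF, Nat.cast_zero, rfl⟩
  | @prec_succ f g x n y z _ _ h1 h2 =>
    rw [hprec] at h1 ⊢
    refine hM.attainable_fact [_, _] (forall_mem_pair.2 ⟨h1, h2⟩)
      f.encodeCode g.encodeCode x n y z fun F hF => ?_
    obtain ⟨h1, h2⟩ := forall_mem_pair.1 hF
    exact .inr <| .inr <| .inr <| .inr <| .inr <| .inr <| .inr <| .inl ⟨h1, h2, rfl⟩
  | @rfind_zero f x n _ h1 =>
    refine hM.attainable_fact [_] (List.forall_mem_singleton.2 h1)
      f.encodeCode 0 x n 0 0 fun F hF => ?_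
    rw [hrfind]
    refine .inr <| .inr <| .inr <| .inr <| .inr <| .inr <| .inr <| .inr <| .inl ⟨?_, rfl⟩
    simpa using hF
  | @rfind_succ f x n y z _ _ h1 h2 =>
    rw [hrfind] at h2 ⊢
    refine hM.attainable_fact [_, _] (forall_mem_pair.2 ⟨h1, h2⟩)
      -- The slot `u` is the result of the search, and `v` is the predecessor of the nonzero value
      -- of `f`.
      f.encodeCode 0 x n z y fun F hF => ?_
    obtain ⟨h1, h2⟩ := forall_mem_pair.1 hF
    rw [Nat.cast_succ] at h1
    exact .inr <| .inr <| .inr <| .inr <| .inr <| .inr <| .inr <| .inr <| .inr ⟨h1, h2, rfl⟩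

/-- The right side does not mention `M`, so all models give the same answer, and entailment can be
tested in any one of them. -/
theorem IsModel.exists_holds_haltQuery (c : Code) :
    (∃ s, M.Exec s ∧ M.Holds s (haltQuery c.encodeCode)) ↔ (c.eval 0).Dom := by
  simp only [holds_haltQuery, Part.dom_iff_mem]
  constructor
  · rintro ⟨s, hs, y, hy, h⟩
    obtain ⟨hN, hF⟩ := hM.occ_sound s hs
    obtain ⟨n, rfl⟩ := hN y hy
    obtain ⟨c', x', y', h1, h2⟩ := hF _ h
    rw [← Nat.cast_zero] at h1
    obtain ⟨hc, rfl, rfl⟩ := triple_inj h1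
    obtain rfl : c = c' := Encodable.encode_injective hc
    exact ⟨_, h2.mem_eval⟩
  · rintro ⟨y, hy⟩
    obtain ⟨s1, hs1, -, h1⟩ := hM.attainable_nat y _ hM.foundational.exec_s0
    obtain ⟨s2, hs2, hle, h2⟩ := hM.attainable_of_evaluates (evaluates_of_mem_eval hy) s1 hs1
    exact ⟨s2, hs2, y, hle _ _ h1, by rwa [Nat.cast_zero] at h2⟩

end Derivations

end Interp

/-! ### Consistency and complete information -/

/-- The axiom on `⊏` and `do` when situations are lists of actions ordered by proper suffix. -/
theorem suffix_cons_and_ne {α : Type} (a : α) (s s' : List α) :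
    s <:+ a :: s' ∧ s ≠ a :: s' ↔ (s <:+ s' ∧ s ≠ s') ∨ s = s' := by
  have ne (h : s <:+ s') : s ≠ a :: s' := by
    rintro rfl
    simpa using h.length_le
  rw [List.suffix_cons_iff]
  constructor
  · rintro ⟨rfl | h, h'⟩
    · exact (h' rfl).elim
    · by_cases hs : s = s'
      · exact .inr hs
      · exact .inl ⟨h, hs⟩
  · rintro (⟨h, -⟩ | rfl)
    · exact ⟨.inr h, ne h⟩
    · exact ⟨.inr List.suffix_rfl, ne List.suffix_rfl⟩

/-- The canonical model: situations are finite sequences of actions, the last action first. -/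
noncomputable def derivModel : Interp derivSig where
  Obj := Unit
  Act := Fin derivSig.actions.length × ℝ
  Sit := List (Fin derivSig.actions.length × ℝ)
  const _ := ()
  act A _ τ := (A, τ)
  s0 := []
  doAct := List.cons
  before s s' := s <:+ s' ∧ s ≠ s'
  -- Membership in the list replaces `Occ`, which refers to the interpretation being defined;
  -- `derivModel_occ` shows that the two agree.
  poss α s := if α.1 = natType then NatCond (fun r => (natType, r) ∈ s) α.2
    else FactCond (fun r => (natType, r) ∈ s) (fun r => (factType, r) ∈ s) α.2
  time := Prod.snd
  -- The default value `0` is the start of the empty list, as the initial axiom demands.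
  start s := (s.map Prod.snd).headD 0
  rel F := Fin.elim0 F
  objFluent f := Fin.elim0 f
  timeFluent f := Fin.elim0 f
  rigidRel F := Fin.elim0 F
  rigidObj f := Fin.elim0 f
  rigidTime f := Fin.elim0 f

theorem derivModel_foundational : derivModel.Foundational where
  doAct_inj _ _ _ _ h := List.cons.inj h
  induction _ h0 h s := List.rec h0 (fun α s => h α s) s
  not_before_s0 _ h := h.2 (List.suffix_nil.1 h.1)
  before_doAct α s s' := suffix_cons_and_ne α s s'
  time_act _ _ _ := rfl
  start_doAct _ _ := rfl

theorem derivModel_occ (s : List (Fin derivSig.actions.length × ℝ)) (A) (r : ℝ) :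
    derivModel.Occ s A r ↔ (A, r) ∈ s := by
  induction s with
  | nil => exact iff_of_false (derivModel_foundational.not_occursT_s0 _ _) List.not_mem_nil
  | cons α s ih =>
    refine (derivModel_foundational.occursT_doAct _ α r s).trans ?_
    rw [List.mem_cons, ← ih]
    refine or_congr_left ⟨fun h => h.1, ?_⟩
    rintro rfl
    exact ⟨rfl, rfl⟩

theorem derivModel_isModel : derivModel.IsModel derivBAT where
  foundational := derivModel_foundational
  names :=
    { const_inj := fun _ _ _ => Subsingleton.elim (α := Fin 1) _ _
      const_surj := fun _ => ⟨(0 : Fin 1), rfl⟩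
      act_closure := fun α => ⟨α.1, fun _ => (), α.2, rfl⟩
      act_ne := fun _ _ _ _ _ _ h e => h (congrArg Prod.fst e)
      act_inj := fun _ _ _ _ _ h => ⟨funext fun _ => rfl, congrArg Prod.snd h⟩ }
  initial := by
    intro φ hφ
    obtain rfl := List.mem_singleton.1 hφ
    exact Nat.cast_zero.symm
  poss A x τ s := by
    have h (A) : derivModel.Occ s A = fun r =>
        (A, r) ∈ (show List (Fin derivSig.actions.length × ℝ) from s) :=
      funext fun r => propext (derivModel_occ s A r)
    by_cases hA : A = natType
    · simp only [derivBAT, if_pos hA]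
      rw [Interp.sat_natCond, h]
      exact iff_of_eq (if_pos hA)
    · simp only [derivBAT, if_neg hA]
      rw [Interp.sat_factCond, h, h]
      exact iff_of_eq (if_neg hA)
  ssaRel F := Fin.elim0 F
  ssaObj f := Fin.elim0 f
  ssaTime f := Fin.elim0 f

/-- Agreement of values in two models of `derivBAT`. -/
def Interp.SameValue (M N : Interp derivSig) : (σ : Srt) → M.Carrier σ → N.Carrier σ → Prop
  | .obj, _, _ => True
  | .time, (x : ℝ), (y : ℝ) => x = y
  | .act, α, β => ∃ A x y τ, α = M.act A x τ ∧ β = N.act A y τ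

/-- With no function symbols besides arithmetic and actions, a closed term of sort time is built
from numerals, `start` and times of actions; the initial axiom fixes `start`. -/
theorem Interp.sameValue_eval {M N : Interp derivSig} (hM : M.IsModel derivBAT)
    (hN : N.IsModel derivBAT) {σ : Srt} (x : Term derivSig 0 0 0 σ) :
    M.SameValue N σ (M.eval M.s0 Fin.elim0 Fin.elim0 Fin.elim0 x)
      (N.eval N.s0 Fin.elim0 Fin.elim0 Fin.elim0 x) := by
  have start {M : Interp derivSig} (hM : M.IsModel derivBAT) : M.start M.s0 = ((0 : ℕ) : ℝ) :=
    hM.initial (.eqTime .start (.num 0)) List.mem_cons_self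
  induction x with
  | objVar | const | objFluent | rigidObj => trivial
  | timeVar i | actVar i => exact i.elim0
  | timeFluent f | rigidTime f => exact Fin.elim0 f
  | num => rfl
  | add _ _ h1 h2 => exact congrArg₂ (α := ℝ) (β := ℝ) (· + ·) h1 h2
  | sub _ _ h1 h2 => exact congrArg₂ (α := ℝ) (β := ℝ) (· - ·) h1 h2
  | mul _ _ h1 h2 => exact congrArg₂ (α := ℝ) (β := ℝ) (· * ·) h1 h2
  | start => exact (start hM).trans (start hN).symm
  | timeOf _ h =>
    obtain ⟨A, x, y, τ, h1, h2⟩ := h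
    change M.time _ = N.time _
    rw [h1, h2, hM.foundational.time_act, hN.foundational.time_act]
  | act A args x _ h => exact ⟨A, _, _, _, rfl, congrArg (N.act A _) (Eq.symm h)⟩

/-- Objects are all equal, times agree, actions are compared by type and time through unique names,
and nothing has occurred at the initial situation. -/
theorem Interp.holds_of_isAtomic {M N : Interp derivSig} (hM : M.IsModel derivBAT)
    (hN : N.IsModel derivBAT) {φ : Sentence derivSig} (hφ : φ.IsAtomic)
    (h : M.Holds M.s0 φ) : N.Holds N.s0 φ := by
  have time (x : Term derivSig 0 0 0 .time) :
      (M.eval M.s0 Fin.elim0 Fin.elim0 Fin.elim0 x : ℝ) =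
        N.eval N.s0 Fin.elim0 Fin.elim0 Fin.elim0 x := sameValue_eval hM hN x
  cases φ with
  | eqObj x y => exact congrFun (hN.args_eq (n := 1) (fun _ => _) fun _ => _) 0
  | eqTime x y => exact (time x).symm.trans (Eq.trans h (time y))
  | lt x y =>
    change (_ : ℝ) < _ at h
    rwa [time, time] at h
  | eqAct x y =>
    change M.eval _ _ _ _ x = M.eval _ _ _ _ y at h
    obtain ⟨A, x1, x2, τ, h1, h2⟩ := sameValue_eval hM hN x
    obtain ⟨B, y1, y2, υ, h3, h4⟩ := sameValue_eval hM hN y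
    rw [h1, h3] at h
    obtain rfl : A = B := by
      by_contra hAB
      exact hM.names.act_ne _ _ _ _ _ _ hAB h
    obtain ⟨-, rfl⟩ := hM.names.act_inj _ _ _ _ _ h
    change N.eval _ _ _ _ x = N.eval _ _ _ _ y
    rw [h2, h4, hN.args_eq x2 y2]
  | rel R | rigidRel R => exact Fin.elim0 R
  | occursT x y => exact (hM.foundational.not_occursT_s0 _ _ h).elim
  | falsum | imp | allObj | allTime | allAct => exact hφ.elim

/-- Atomic truth transfers between any two models, so the canonical model decides for all of them.
-/
theorem derivBAT_completeInformation : derivBAT.CompleteInformation := by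
  intro φ hφ
  by_cases h : derivModel.Holds derivModel.s0 φ
  · exact .inl fun M hM => Interp.holds_of_isAtomic derivModel_isModel hM hφ h
  · exact .inr fun M hM h' => h (Interp.holds_of_isAtomic hM derivModel_isModel hφ h')

theorem derivBAT_reachable_haltQuery (c : Code) :
    derivBAT.Reachable (haltQuery c.encodeCode) ↔ (c.eval 0).Dom :=
  ⟨fun h => (derivModel_isModel.exists_holds_haltQuery c).1 (h _ derivModel_isModel),
    fun h _ hM => (hM.exists_holds_haltQuery c).2 h⟩

/-! ### Computability of the reduction -/

theorem Formula.primrec_code_imp {S : Signature} {o t a : ℕ} {p q : ℕ → Formula S o t a}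
    (hp : Primrec fun n => (p n).code) (hq : Primrec fun n => (q n).code) :
    Primrec fun n => ((p n).imp (q n)).code := by
  simp only [Formula.code]
  exact Primrec₂.natPair.comp (.const _) (Primrec₂.natPair.comp hp hq)

theorem Formula.primrec_code_neg {S : Signature} {o t a : ℕ} {p : ℕ → Formula S o t a}
    (hp : Primrec fun n => (p n).code) : Primrec fun n => (p n).neg.code :=
  primrec_code_imp hp (.const _)

theorem Formula.primrec_code_and {S : Signature} {o t a : ℕ} {p q : ℕ → Formula S o t a}
    (hp : Primrec fun n => (p n).code) (hq : Primrec fun n => (q n).code) :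
    Primrec fun n => ((p n).and (q n)).code :=
  primrec_code_neg (primrec_code_imp hp (primrec_code_neg hq))

theorem Formula.primrec_code_exTimes {S : Signature} {o t a : ℕ} (k : ℕ)
    {p : ℕ → Formula S o (t + k) a} (hp : Primrec fun n => (p n).code) :
    Primrec fun n => ((p n).exTimes k).code := by
  induction k with
  | zero => exact hp
  | succ k ih =>
    refine ih (primrec_code_neg ?_)
    simp only [Formula.code]
    exact Primrec₂.natPair.comp (.const _) (primrec_code_neg hp)

theorem primrec_code_haltQuery : Primrec fun n => (haltQuery n).code := by
  refine Formula.primrec_code_exTimes 2 (Formula.primrec_code_and ?_ (.const _))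
  simp only [Formula.code, Term.code]
  exact Primrec₂.natPair.comp (.const _) (Primrec₂.natPair.comp (.const _)
    (Primrec₂.natPair.comp (.const _) .id))

theorem ReachInstance.primrec_code {S : Signature} (D : TimedBAT S) {φ : ℕ → Sentence S}
    (h : Primrec fun n => (φ n).code) : Primrec fun n => (ReachInstance.mk S D (φ n)).code := by
  simp only [ReachInstance.code]
  exact Primrec₂.natPair.comp (.const _) (Primrec₂.natPair.comp (.const _) h)

/-- The instance asking whether the code with number `n` halts at `0`. -/
def haltInstance (n : ℕ) : ReachInstance := ⟨derivSig, derivBAT, haltQuery n⟩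

theorem primrec_code_haltInstance : Primrec fun n => (haltInstance n).code :=
  ReachInstance.primrec_code derivBAT primrec_code_haltQuery

end SitCalc

/-! ### Undecidability by reduction from halting at input `0` -/

theorem mainTheorem5 :
    ¬ ∃ decider : ℕ → Bool, Computable decider ∧
      ∀ I : SitCalc.ReachInstance,
        0 < I.sig.numObj → I.bat.Consistent → I.bat.CompleteInformation →
        ¬ I.bat.IsRealValued →
        (decider I.code = true ↔ I.bat.Reachable I.query) := by
  rintro ⟨decider, hd, h⟩
  refine ComputablePred.halting_problem 0 (ComputablePred.computable_iff.2
    ⟨fun c => decider (SitCalc.haltInstance (Encodable.encode c)).code,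
      hd.comp (SitCalc.primrec_code_haltInstance.to_comp.comp Computable.encode), ?_⟩)
  funext c
  have := h (SitCalc.haltInstance c.encodeCode) Nat.one_pos ⟨_, SitCalc.derivModel_isModel⟩
    SitCalc.derivBAT_completeInformation fun hr => hr rfl
  rw [Nat.Partrec.Code.encodeCode_eq]
  exact propext (this.trans (SitCalc.derivBAT_reachable_haltQuery c)).symm
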